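/- Let $M$ be a smooth manifold of dimension $d\ge 3$ with a conformal structure $c$ of any signature, i.e. an equivalence class of smooth pseudo-Riemannian metrics under $g\sim e^{2\Upsilon}g$, $\Upsilon\in C^\infty(M)$. For $w\in\mathbb C$ let $\mathcal E[w]$ be the bundle of (complex) conformal densities of weight $w$: a section is a family of smooth functions $f_g$, $g\in c$, with $f_{e^{2\Upsilon}g}=e^{w\Upsilon}f_g$. Let $\mathcal T$ be the standard tractor bundle: for each $g\in c$, $\mathcal T\cong_g\mathcal E[1]\oplus T^*M[1]\oplus\mathcal E[-1]$, where for $\hat g=e^{2\Upsilon}g$ the triples are related by $(\hat\sigma,\hat\mu_b,\hat\rho)=(\sigma,\ \mu_b+\sigma\Upsilon_b,\ \rho-g^{cd}\Upsilon_c\mu_d-\tfrac12\sigma g^{cd}\Upsilon_c\Upsilon_d)$, $\Upsilon_a=\nabla_a\Upsilon$. It carries the tractor metric $h(T,T)=g^{ab}\mu_a\mu_b+2\sigma\rho$ and the tractor connection $\nabla_a(\sigma,\mu_b,\rho)=(\nabla_a\sigma-\mu_a,\ \nabla_a\mu_b+g_{ab}\rho+P_{ab}\sigma,\ \nabla_a\rho-P_{ac}\mu^c)$,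 where $P_{ab}$ is the Schouten tensor of $g$, $\mathrm{Ric}_{ab}=(d-2)P_{ab}+Jg_{ab}$, $J=g^{ab}P_{ab}$. For a tractor bundle $\mathcal E^\Phi$ (a tensor power of $\mathcal T$, or a tensor part of one) put $\mathcal E^\Phi[w]=\mathcal E^\Phi\otimes\mathcal E[w]$; the weight operator $\mathbf w$ is multiplication by $w$ on sections of $\mathcal E^\Phi[w]$. The Thomas operator $D_A$ from sections of $\mathcal E^\Phi[w]$ to sections of $\mathcal T\otimes\mathcal E^\Phi[w-1]$ is given in the scale $g$ by $$D_AV=\big((d+2w-2)\,wV,\ (d+2w-2)\nabla_aV,\ -(\Delta V+wJV)\big),\qquad \Delta=g^{ab}\nabla_a\nabla_b,$$ with $\nabla$ the coupled Levi-Civita–tractor connection. Let $\sigma$ be a section of $\mathcal E[1]$, let $I_A=\frac1d D_A\sigma$ be its scale tractor, $I^2=I^AI_A$ (the square for $h$), and $I\cdot D=I^AD_A$, which maps sections of $\mathcal E^\Phi[w]$ to sections of $\mathcal E^\Phi[w-1]$. (i) If $I^2$ is nowhere zero, then the operators $x=\sigma$ (multiplication by $\sigma$), $y=-\frac1{I^2}\,I\cdot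 D$ and $h=d+2\mathbf w$ on sections of weighted tractor bundles $\mathcal E^\Phi[w]$ ($w\in\mathbb C$) satisfy $$[h,x]=2x,\qquad [h,y]=-2y,\qquad [x,y]=h,$$ the relations of standard $\mathfrak{sl}(2)$ generators. (ii) If $I^2=0$ identically, then with the same $x$ and $h$, and with $y=-I\cdot D$, $$[h,x]=2x,\qquad [h,y]=-2y,\qquad [x,y]=0,$$ an Inönü–Wigner contraction of $\mathfrak{sl}(2)$. -/

import Mathlib

open scoped Manifold ContDiff

noncomputable section

namespace ConformalTractor

/-! ## Local coordinate formulas -/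

section Coordinates

variable {d : ℕ} {H : Type*} [TopologicalSpace H]

/-- The partial derivative `∂_a F` at `u`, for a function of the coordinates `u ∈ ℝ^d`.
It is taken within the range of the model (all of `ℝ^d` for a manifold without boundary,
a half space for a manifold with boundary). -/
def pd (I : ModelWithCorners ℝ (EuclideanSpace ℝ (Fin d)) H)
    {V : Type*} [NormedAddCommGroup V] [NormedSpace ℝ V]
    (a : Fin d) (F : EuclideanSpace ℝ (Fin d) → V) (u : EuclideanSpace ℝ (Fin d)) : V :=
  fderivWithin ℝ F (Set.range I) u (EuclideanSpace.single a 1)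

variable (I : ModelWithCorners ℝ (EuclideanSpace ℝ (Fin d)) H)
  (G : EuclideanSpace ℝ (Fin d) → Matrix (Fin d) (Fin d) ℝ) (u : EuclideanSpace ℝ (Fin d))

/-- Christoffel symbols `Γ^c_{ab}` of the Levi-Civita connection of the metric `G_{ab}`. -/
def christoffel (c a b : Fin d) : ℝ :=
  (1 / 2) * ∑ e, (G u)⁻¹ c e *
    (pd I a (fun v => G v b e) u + pd I b (fun v => G v a e) u - pd I e (fun v => G v a b) u)

/-- `R_{ab}{}^c{}_e`, with `R(X,Y)Z = ∇_X ∇_Y Z - ∇_Y ∇_X Z - ∇_{[X,Y]} Z`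
and `R(X,Y)Z = X^a Y^b Z^e R_{ab}{}^c{}_e`. -/
def riemann (a b c e : Fin d) : ℝ :=
  pd I a (fun v => christoffel I G v c b e) u - pd I b (fun v => christoffel I G v c a e) u
    + ∑ f, (christoffel I G u c a f * christoffel I G u f b e
        - christoffel I G u c b f * christoffel I G u f a e)

/-- `Ric_{ab} = R_{ca}{}^c{}_b`. -/
def ricci (a b : Fin d) : ℝ := ∑ c, riemann I G u c a c b

/-- The scalar curvature `Sc = g^{ab} Ric_{ab}`. -/
def scalarCurvature : ℝ := ∑ a, ∑ b, (G u)⁻¹ a b * ricci I G u a b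

/-- The trace `J = g^{ab} P_{ab}` of the Schouten tensor, `J = Sc / (2 (d - 1))`. -/
def schoutenTrace : ℝ := scalarCurvature I G u / (2 * ((d : ℝ) - 1))

/-- The Schouten tensor `P_{ab}`, determined by `Ric_{ab} = (d - 2) P_{ab} + J g_{ab}`. -/
def schouten (a b : Fin d) : ℝ :=
  (ricci I G u a b - schoutenTrace I G u * G u a b) / ((d : ℝ) - 2)

/-- Index set of the `d + 2` components of a standard tractor `(σ, μ_a, ρ)`:
the top slot `σ`, the slots `μ_a`, and the bottom slot `ρ`. -/
abbrev TIdx (d : ℕ) : Type := Unit ⊕ Fin d ⊕ Unit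

/-- The matrix of the standard tractor connection coupled to the Levi-Civita connection:
`(∇_a T)_B = ∂_a T_B + ∑_C (tractorConn a B C) T_C`, that is
`∇_a (σ, μ_b, ρ) = (∂_a σ - μ_a, ∇_a μ_b + g_{ab} ρ + P_{ab} σ, ∂_a ρ - P_{ac} μ^c)`. -/
def tractorConn (a : Fin d) : TIdx d → TIdx d → ℝ
  | .inl _, .inl _ => 0
  | .inl _, .inr (.inl c) => if c = a then -1 else 0
  | .inl _, .inr (.inr _) => 0
  | .inr (.inl b), .inl _ => schouten I G u a b
  | .inr (.inl b), .inr (.inl c) => - christoffel I G u c a b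
  | .inr (.inl b), .inr (.inr _) => G u a b
  | .inr (.inr _), .inl _ => 0
  | .inr (.inr _), .inr (.inl c) => - ∑ e, schouten I G u a e * (G u)⁻¹ e c
  | .inr (.inr _), .inr (.inr _) => 0

/-- The (inverse) tractor metric `h^{AB}` on the components `(σ, μ_a, ρ)`, where `N = (g^{ab})`:
`h(T, T') = σ ρ' + ρ σ' + g^{ab} μ_a μ'_b`. -/
def tractorMetric (N : Matrix (Fin d) (Fin d) ℝ) : TIdx d → TIdx d → ℝ
  | .inl _, .inr (.inr _) => 1
  | .inr (.inr _), .inl _ => 1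
  | .inr (.inl a), .inr (.inl b) => N a b
  | _, _ => 0

variable {k : ℕ} (F : EuclideanSpace ℝ (Fin d) → (Fin k → TIdx d) → ℂ)

/-- The tractor connection on the components `F_{B_1 … B_k}` of a tractor tensor of rank `k`. In the
trivialisation of the density bundles given by the metric, weights contribute no further term. -/
def nabla (a : Fin d) (B : Fin k → TIdx d) : ℂ :=
  pd I a (fun v => F v B) u
    + ∑ i, ∑ C, (tractorConn I G u a (B i) C : ℂ) * F u (Function.update B i C)

/-- The Laplacian `Δ F = g^{ab} ∇_a ∇_b F` of the coupled Levi-Civita–tractor connection. -/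
def laplacian (B : Fin k → TIdx d) : ℂ :=
  ∑ a, ∑ b, ((G u)⁻¹ a b : ℂ) *
    (nabla I G u (fun v => nabla I G v F b) a B
      - ∑ c, (christoffel I G u c a b : ℂ) * nabla I G u F c B)

/-- The components `(D_A F)_{B_1 … B_k}` of the Thomas D-operator on weight `w`; the new index `A` is
the `0`-th index of the result:
`D F = ((d + 2w - 2) w F, (d + 2w - 2) ∇_a F, -(Δ F + w J F))`. -/
def thomasDComp (w : ℂ) (A : Fin (k + 1) → TIdx d) : ℂ :=
  match A 0 with
  | .inl _ => ((d : ℂ) + 2 * w - 2) * w * F u (Fin.tail A)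
  | .inr (.inl a) => ((d : ℂ) + 2 * w - 2) * nabla I G u F a (Fin.tail A)
  | .inr (.inr _) =>
      -(laplacian I G u F (Fin.tail A) + w * (schoutenTrace I G u : ℂ) * F u (Fin.tail A))

end Coordinates

/-! ## Conformal manifolds -/

section Manifold

variable {d : ℕ} {H : Type*} [TopologicalSpace H]
  (I : ModelWithCorners ℝ (EuclideanSpace ℝ (Fin d)) H)
  {M : Type*} [TopologicalSpace M] [ChartedSpace H M]

/-- The coordinate vector field `∂_a` of the chart at `p`, at the point with coordinates `u`. -/
def coordVec (p : M) (u : EuclideanSpace ℝ (Fin d)) (a : Fin d) :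
    TangentSpace I ((extChartAt I p).symm u) :=
  mfderivWithin 𝓘(ℝ, EuclideanSpace ℝ (Fin d)) I (extChartAt I p).symm (Set.range I) u
    (EuclideanSpace.single a 1 : EuclideanSpace ℝ (Fin d))

variable (M) in
/-- A smooth pseudo-Riemannian metric, of any signature. -/
structure PseudoRiemannianMetric where
  val : ∀ p : M, LinearMap.BilinForm ℝ (TangentSpace I p)
  symm : ∀ p X Y, val p X Y = val p Y X
  nondegenerate : ∀ p X, (∀ Y, val p X Y = 0) → X = 0
  smooth : ∀ (p : M) (a b : Fin d), ContDiffOn ℝ ∞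
    (fun u => val ((extChartAt I p).symm u) (coordVec I p u a) (coordVec I p u b))
    (extChartAt I p).target

/-- `g' = e^{2Υ} g`. -/
def IsRescaling {I : ModelWithCorners ℝ (EuclideanSpace ℝ (Fin d)) H}
    (g g' : PseudoRiemannianMetric I M) (Υ : M → ℝ) : Prop :=
  ContMDiff I 𝓘(ℝ, ℝ) ∞ Υ ∧ ∀ p X Y, g'.val p X Y = Real.exp (2 * Υ p) * g.val p X Y

variable (M) in
/-- A conformal structure `c`: an equivalence class of metrics under `g ∼ e^{2Υ} g`. -/
structure ConformalStructure where
  metrics : Set (PseudoRiemannianMetric I M)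
  nonempty : metrics.Nonempty
  mem_iff : ∀ g ∈ metrics, ∀ g', g' ∈ metrics ↔ ∃ Υ : M → ℝ, IsRescaling g g' Υ

/-- The matrix `g_{ab}` of a metric in the chart at `p`. -/
def chartMetric {I : ModelWithCorners ℝ (EuclideanSpace ℝ (Fin d)) H}
    (g : PseudoRiemannianMetric I M) (p : M) (u : EuclideanSpace ℝ (Fin d)) :
    Matrix (Fin d) (Fin d) ℝ :=
  Matrix.of fun a b => g.val ((extChartAt I p).symm u) (coordVec I p u a) (coordVec I p u b)

/-! ## Tractors -/

/-- The fibre at `p` of (the complexification of) the `k`-th tensor power of the standard tractor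
bundle, as seen in a scale `g ∈ c`. In such a scale the standard tractor bundle is
`ℂ ⊕ T*M ⊗ ℂ ⊕ ℂ ∋ (σ, μ, ρ)`. It is the space of `ℝ`-linear maps `ℝ ⊕ T_pM ⊕ ℝ → ℂ`, where
`(σ, μ, ρ)` is the map `(s, v, r) ↦ s σ + μ(v) + r ρ`; its `k`-th tensor power is the space of
`k`-linear maps. For `k = 0` this is `ℂ`. -/
abbrev TractorFibre (k : ℕ) (p : M) : Type _ :=
  MultilinearMap ℝ (fun _ : Fin k => ℝ × TangentSpace I p × ℝ) ℂ

/-- The frame of `ℝ ⊕ T_qM ⊕ ℝ` that the chart at `p` gives at the point `q` with coordinates `u`;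
evaluation on it yields the components of tractors. -/
def chartFrame (p : M) (u : EuclideanSpace ℝ (Fin d)) :
    TIdx d → ℝ × TangentSpace I ((extChartAt I p).symm u) × ℝ
  | .inl _ => (1, 0, 0)
  | .inr (.inl a) => (0, coordVec I p u a, 0)
  | .inr (.inr _) => (0, 0, 1)

variable {I}

/-- The components `F_{B_1 … B_k}` in the chart at `p` of a rank `k` tractor field. -/
def chartComp {k : ℕ} (f : ∀ q : M, TractorFibre I k q) (p : M) (u : EuclideanSpace ℝ (Fin d))
    (B : Fin k → TIdx d) : ℂ :=
  f ((extChartAt I p).symm u) fun i => chartFrame I p u (B i)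

variable (I) in
/-- The coordinate functions on `ℝ ⊕ T_pM ⊕ ℝ` for the chart at `p`, at the point `p` itself.
(`TangentSpace I p` is by definition `ℝ^d`, the identification being through the chart at `p`.) -/
def coordAt (p : M) : TIdx d → (ℝ × TangentSpace I p × ℝ) →ₗ[ℝ] ℝ
  | .inl _ => LinearMap.fst ℝ ℝ (TangentSpace I p × ℝ)
  | .inr (.inl a) =>
      (EuclideanSpace.proj a : EuclideanSpace ℝ (Fin d) →L[ℝ] ℝ).toLinearMap ∘ₗ
        LinearMap.fst ℝ (TangentSpace I p) ℝ ∘ₗ LinearMap.snd ℝ ℝ (TangentSpace I p × ℝ)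
  | .inr (.inr _) =>
      LinearMap.snd ℝ (TangentSpace I p) ℝ ∘ₗ LinearMap.snd ℝ ℝ (TangentSpace I p × ℝ)

variable (I) in
/-- The tractor tensor at `p` with given components in the chart at `p`. -/
def ofComponents {k : ℕ} (p : M) (C : (Fin k → TIdx d) → ℂ) : TractorFibre I k p :=
  ∑ B, ((MultilinearMap.mkPiAlgebra ℝ (Fin k) ℝ).compLinearMap
    fun i => coordAt I p (B i)).smulRight (C B)

/-- The change of scale from `g` to `e^{2Υ} g`, written on the arguments `(s, v, r)` of tractors. Here
`t = e^{Υ(p)}`, `η = dΥ(p)` and `N` is the vector `g`-dual to `η`. As functions, in the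
trivialisations of the density bundles belonging to the two metrics,
`(σ, μ, ρ) ↦ (t σ, t (μ + σ η), t⁻¹ (ρ - g⁻¹(η, μ) - ½ σ g⁻¹(η, η)))`. -/
def changeScale {p : M} (t : ℝ) (η : TangentSpace I p → ℝ) (N : TangentSpace I p)
    (T : ℝ × TangentSpace I p × ℝ) : ℝ × TangentSpace I p × ℝ :=
  (t * (T.1 + η T.2.1) - t⁻¹ * T.2.2 * (η N / 2), t • T.2.1 - (t⁻¹ * T.2.2) • N, t⁻¹ * T.2.2)

/-- A rank `k` tractor field on a conformal manifold, through its representatives in all the scales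
`g ∈ c` (no regularity and no compatibility required yet). -/
abbrev TractorField (c : ConformalStructure I M) (k : ℕ) : Type _ :=
  ∀ (_ : c.metrics) (p : M), TractorFibre I k p

/-- `f` is a smooth section of weight `w` of the `k`-th tensor power of the standard tractor bundle:
its representatives are smooth and those in any two scales of `c` are related by the tractor
transformation law. For `k = 0` this is a density of weight `w`, with law `f̂ = e^{wΥ} f`. -/
structure IsSection (c : ConformalStructure I M) {k : ℕ} (w : ℂ) (f : TractorField c k) : Prop where
  smooth : ∀ (g : c.metrics) (p : M) (B : Fin k → TIdx d),
    ContDiffOn ℝ ∞ (fun u => chartComp (f g) p u B) (extChartAt I p).target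
  covariant : ∀ (g g' : c.metrics) (Υ : M → ℝ), IsRescaling g.1 g'.1 Υ →
    ∀ (p : M) (N : TangentSpace I p),
      (∀ X : TangentSpace I p, g.1.val p N X = mfderiv I 𝓘(ℝ, ℝ) Υ p X) →
      ∀ T : Fin k → ℝ × TangentSpace I p × ℝ,
        f g' p T = Complex.exp (w * (Υ p : ℂ)) *
          f g p fun i => changeScale (Real.exp (Υ p)) (mfderiv I 𝓘(ℝ, ℝ) Υ p) N (T i)

/-! ## The Thomas D-operator, the scale tractor and the degenerate Laplacian -/

variable {c : ConformalStructure I M} {k : ℕ}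

/-- The Thomas D-operator `D_A` on fields of weight `w`. -/
def thomasD (w : ℂ) (f : TractorField c k) : TractorField c (k + 1) := fun g p =>
  ofComponents I p
    (thomasDComp I (chartMetric g.1 p) (extChartAt I p p) (chartComp (f g) p) w)

/-- The contraction `V^A F_{A B_1 … B_k}` by the tractor metric. -/
def contract (V : TractorField c 1) (F : TractorField c (k + 1)) : TractorField c k := fun g p =>
  ofComponents I p fun B => ∑ A, ∑ C,
    (tractorMetric (chartMetric g.1 p (extChartAt I p p))⁻¹ A C : ℂ) *
      chartComp (V g) p (extChartAt I p p) (fun _ => A) *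
      chartComp (F g) p (extChartAt I p p) (Fin.cons C B)

/-- The complex number that a field of rank `0` is at a point, in the scale `g`. -/
def scalar (s : TractorField c 0) (g : c.metrics) (p : M) : ℂ := s g p Fin.elim0

/-- The scale tractor `I_A = (1/d) D_A σ` of a density `σ` of weight `1`. -/
def scaleTractor (σ : TractorField c 0) : TractorField c 1 :=
  (1 / (d : ℂ)) • thomasD 1 σ

/-- `I² = I^A I_A`, in the scale `g` and at the point `p`. -/
def scaleTractorSq (σ : TractorField c 0) (g : c.metrics) (p : M) : ℂ :=
  scalar (contract (scaleTractor σ) (scaleTractor σ)) g p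

/-- `I·D = I^A D_A` on fields of weight `w`. -/
def degenerateLaplacian (σ : TractorField c 0) (w : ℂ) (f : TractorField c k) : TractorField c k :=
  contract (scaleTractor σ) (thomasD w f)

/-! ## Operators on weighted tractor fields -/

/-- Weighted tractor fields of rank `k`, of all weights: `F w` is the part of weight `w`. -/
abbrev WeightedField (c : ConformalStructure I M) (k : ℕ) : Type _ := ℂ → TractorField c k

/-- `F` consists of smooth sections: the part `F w` is a section of weight `w`. A single section
`f` of weight `w` is `Pi.single w f`. -/
def IsWeightedSection (F : WeightedField c k) : Prop := ∀ w, IsSection c w (F w)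

/-- `x = σ`, multiplication by `σ`; it raises the weight by one. -/
def opX (σ : TractorField c 0) (F : WeightedField c k) : WeightedField c k :=
  fun w g p => scalar σ g p • F (w - 1) g p

/-- `I·D`; it lowers the weight by one. -/
def opID (σ : TractorField c 0) (F : WeightedField c k) : WeightedField c k :=
  fun w => degenerateLaplacian σ (w + 1) (F (w + 1))

/-- `y = -(1/I²) I·D`. -/
def opY (σ : TractorField c 0) (F : WeightedField c k) : WeightedField c k :=
  fun w g p => -(1 / scaleTractorSq σ g p) • opID σ F w g p

/-- The weight operator: multiplication by `w` on weight `w`. -/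
def opW (F : WeightedField c k) : WeightedField c k := fun w => w • F w

/-- `h = d + 2w`, with `w` the weight operator. -/
def opH (F : WeightedField c k) : WeightedField c k := (d : ℂ) • F + (2 : ℂ) • opW F

/-- The commutator `[A, B] = A ∘ B - B ∘ A`. -/
def comm (A B : WeightedField c k → WeightedField c k) (F : WeightedField c k) :
    WeightedField c k :=
  A (B F) - B (A F)

end Manifold

end ConformalTractor

end

open scoped Manifold ContDiff

noncomputable section

namespace ConformalTractor

/-! ### Smoothness and product rules for the tractor connection in coordinates -/

section CoordinateCalculus

variable {d : ℕ} {H : Type*} [TopologicalSpace H]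
  {I : ModelWithCorners ℝ (EuclideanSpace ℝ (Fin d)) H}
  {u : EuclideanSpace ℝ (Fin d)}

/-! Everything reduces to one pointwise identity in a fixed scale: for `f` of weight `w`, `I·D (σ f)
- σ I·D f = (d + 2w) I² f` (`degenerateLaplacian_smul_sub`).

Contracting the slots, with `ρ = -(Δσ + Jσ)/d` the bottom slot of the scale tractor, gives `I·D f =
-σ(Δf + wJf) + (d + 2w - 2)(⟨∇σ, ∇f⟩ + wρf)` and `I² = ⟨∇σ, ∇σ⟩ + 2σρ`. Since `σ f` has weight `w +
1`, its first-order coefficient is `d + 2w`. In the difference the terms in `σ⟨∇σ, ∇f⟩` carry `-2 +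
(d + 2w) - (d + 2w - 2) = 0`; the term `-σ(Δσ + Jσ)f` equals `dσρf`, and all terms in `σρf` add up
to `d + (d + 2w)(w + 1) - (d + 2w - 2)w = 2(d + 2w)`. With `(d + 2w)⟨∇σ, ∇σ⟩f` this is the identity.
The connection enters only through its Leibniz rule (`laplacian_mul`), so no curvature has to be
commuted.

Dividing by `-I²`, or setting `I² = 0`, gives the two forms of `[x, y]`. The relations with `h` are
weight counting; the one for `y` also uses that `I·D` commutes with constants. -/

theorem contDiffWithinAt_pd {V : Type*} [NormedAddCommGroup V] [NormedSpace ℝ V]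
    {F : EuclideanSpace ℝ (Fin d) → V} (hu : u ∈ Set.range I)
    (hF : ContDiffWithinAt ℝ ∞ F (Set.range I) u) (a : Fin d) :
    ContDiffWithinAt ℝ ∞ (pd I a F) (Set.range I) u :=
  (hF.fderivWithin_right I.uniqueDiffOn le_rfl hu).clm_apply contDiffWithinAt_const

theorem pd_congr {V : Type*} [NormedAddCommGroup V] [NormedSpace ℝ V]
    {F F' : EuclideanSpace ℝ (Fin d) → V} (hu : u ∈ Set.range I)
    (h : F =ᶠ[nhdsWithin u (Set.range I)] F') (a : Fin d) : pd I a F u = pd I a F' u := by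
  rw [pd, pd, h.fderivWithin_eq_of_mem hu]

theorem pd_add {V : Type*} [NormedAddCommGroup V] [NormedSpace ℝ V]
    {F F' : EuclideanSpace ℝ (Fin d) → V} (hu : u ∈ Set.range I)
    (hF : DifferentiableWithinAt ℝ F (Set.range I) u)
    (hF' : DifferentiableWithinAt ℝ F' (Set.range I) u) (a : Fin d) :
    pd I a (fun v => F v + F' v) u = pd I a F u + pd I a F' u := by
  rw [pd, fderivWithin_fun_add (I.uniqueDiffOn u hu) hF hF']
  rfl

theorem pd_mul {s F : EuclideanSpace ℝ (Fin d) → ℂ} (hu : u ∈ Set.range I)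
    (hs : DifferentiableWithinAt ℝ s (Set.range I) u)
    (hF : DifferentiableWithinAt ℝ F (Set.range I) u) (a : Fin d) :
    pd I a (fun v => s v * F v) u = pd I a s u * F u + s u * pd I a F u := by
  rw [pd, fderivWithin_fun_mul (I.uniqueDiffOn u hu) hs hF]
  simp [pd]
  ring

variable {G : EuclideanSpace ℝ (Fin d) → Matrix (Fin d) (Fin d) ℝ}

theorem contDiffWithinAt_det {s : Set (EuclideanSpace ℝ (Fin d))}
    (hG : ∀ a b, ContDiffWithinAt ℝ ∞ (fun v => G v a b) s u) :
    ContDiffWithinAt ℝ ∞ (fun v => (G v).det) s u := by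
  simp only [Matrix.det_apply']
  exact ContDiffWithinAt.sum fun τ _ =>
    contDiffWithinAt_const.mul (contDiffWithinAt_prod fun i _ => hG _ _)

theorem contDiffWithinAt_inv {s : Set (EuclideanSpace ℝ (Fin d))}
    (hG : ∀ a b, ContDiffWithinAt ℝ ∞ (fun v => G v a b) s u) (hdet : (G u).det ≠ 0)
    (a b : Fin d) : ContDiffWithinAt ℝ ∞ (fun v => (G v)⁻¹ a b) s u := by
  simp only [Matrix.inv_def, Ring.inverse_eq_inv', Matrix.smul_apply, smul_eq_mul,
    Matrix.adjugate_apply]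
  refine ((contDiffWithinAt_det hG).inv hdet).mul (contDiffWithinAt_det fun i j => ?_)
  -- An adjugate entry is the determinant of a matrix whose row `b` is replaced by a constant basis
  -- row.
  by_cases h : i = b
  · subst h
    simpa using contDiffWithinAt_const
  · simpa [Matrix.updateRow_apply, h] using hG i j

theorem contDiffWithinAt_christoffel
    (hu : u ∈ Set.range I)
    (hG : ∀ a b, ContDiffWithinAt ℝ ∞ (fun v => G v a b) (Set.range I) u)
    (hdet : (G u).det ≠ 0)
    (c a b : Fin d) :
    ContDiffWithinAt ℝ ∞ (fun v => christoffel I G v c a b) (Set.range I) u := by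
  unfold christoffel
  exact contDiffWithinAt_const.mul (ContDiffWithinAt.sum fun e _ =>
    (contDiffWithinAt_inv hG hdet c e).mul
      (((contDiffWithinAt_pd hu (hG b e) a).add (contDiffWithinAt_pd hu (hG a e) b)).sub
        (contDiffWithinAt_pd hu (hG a b) e)))

theorem contDiffWithinAt_ricci
    (hu : u ∈ Set.range I)
    (hG : ∀ a b, ContDiffWithinAt ℝ ∞ (fun v => G v a b) (Set.range I) u)
    (hdet : (G u).det ≠ 0)
    (a b : Fin d) :
    ContDiffWithinAt ℝ ∞ (fun v => ricci I G v a b) (Set.range I) u := by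
  have hΓ := contDiffWithinAt_christoffel hu hG hdet
  unfold ricci riemann
  exact ContDiffWithinAt.sum fun c _ =>
    ((contDiffWithinAt_pd hu (hΓ _ _ _) _).sub (contDiffWithinAt_pd hu (hΓ _ _ _) _)).add
      (ContDiffWithinAt.sum fun f _ =>
        ((hΓ _ _ _).mul (hΓ _ _ _)).sub ((hΓ _ _ _).mul (hΓ _ _ _)))

theorem contDiffWithinAt_schouten
    (hu : u ∈ Set.range I)
    (hG : ∀ a b, ContDiffWithinAt ℝ ∞ (fun v => G v a b) (Set.range I) u)
    (hdet : (G u).det ≠ 0)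
    (a b : Fin d) :
    ContDiffWithinAt ℝ ∞ (fun v => schouten I G v a b) (Set.range I) u := by
  have hR := contDiffWithinAt_ricci hu hG hdet
  unfold schouten schoutenTrace scalarCurvature
  exact ((hR a b).sub (((ContDiffWithinAt.sum fun a _ => ContDiffWithinAt.sum fun b _ =>
    (contDiffWithinAt_inv hG hdet a b).mul (hR a b)).div_const _).mul (hG a b))).div_const _

theorem contDiffWithinAt_tractorConn
    (hu : u ∈ Set.range I)
    (hG : ∀ a b, ContDiffWithinAt ℝ ∞ (fun v => G v a b) (Set.range I) u)
    (hdet : (G u).det ≠ 0)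
    (a : Fin d) (B C : TIdx d) :
    ContDiffWithinAt ℝ ∞ (fun v => tractorConn I G v a B C) (Set.range I) u := by
  have hP := contDiffWithinAt_schouten hu hG hdet
  rcases B with _ | b | _ <;> rcases C with _ | c | _ <;> simp only [tractorConn]
  any_goals exact contDiffWithinAt_const
  · exact hP a b
  · exact (contDiffWithinAt_christoffel hu hG hdet c a b).neg
  · exact hG a b
  · exact (ContDiffWithinAt.sum fun e _ =>
      (hP a e).mul (contDiffWithinAt_inv hG hdet e c)).neg

variable {k : ℕ} {F : EuclideanSpace ℝ (Fin d) → (Fin k → TIdx d) → ℂ}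

/-- `Δ` differentiates `∇F` again, so the Leibniz rule will be applied to products containing `∇F`.
-/
theorem contDiffWithinAt_nabla
    (hu : u ∈ Set.range I)
    (hG : ∀ a b, ContDiffWithinAt ℝ ∞ (fun v => G v a b) (Set.range I) u)
    (hdet : (G u).det ≠ 0)
    (hF : ∀ B, ContDiffWithinAt ℝ ∞ (fun v => F v B) (Set.range I) u)
    (a : Fin d) (B : Fin k → TIdx d) :
    ContDiffWithinAt ℝ ∞ (fun v => nabla I G v F a B) (Set.range I) u := by
  unfold nabla
  exact (contDiffWithinAt_pd hu (hF B) a).add (ContDiffWithinAt.sum fun i _ =>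
    ContDiffWithinAt.sum fun C _ =>
      (Complex.ofRealCLM.contDiff.contDiffAt.comp_contDiffWithinAt u
        (contDiffWithinAt_tractorConn hu hG hdet a (B i) C)).mul (hF _))

/-- On functions the tractor connection is the partial derivative. -/
theorem nabla_scalar (s : EuclideanSpace ℝ (Fin d) → ℂ) (v : EuclideanSpace ℝ (Fin d))
    (a : Fin d) :
    nabla I G v (fun v (_ : Fin 0 → TIdx d) => s v) a = fun _ => pd I a s v := by
  ext B
  simp [nabla]

theorem nabla_congr
    (hu : u ∈ Set.range I)
    {F' : EuclideanSpace ℝ (Fin d) → (Fin k → TIdx d) → ℂ}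
    (h : ∀ B, (fun v => F v B) =ᶠ[nhdsWithin u (Set.range I)] fun v => F' v B)
    (a : Fin d) (B : Fin k → TIdx d) : nabla I G u F a B = nabla I G u F' a B := by
  have h' : ∀ B, F u B = F' u B := fun B => (h B).eq_of_nhdsWithin hu
  simp only [nabla, h', pd_congr hu (h B)]

theorem nabla_add
    (hu : u ∈ Set.range I)
    {F' : EuclideanSpace ℝ (Fin d) → (Fin k → TIdx d) → ℂ}
    (hF : ∀ B, DifferentiableWithinAt ℝ (fun v => F v B) (Set.range I) u)
    (hF' : ∀ B, DifferentiableWithinAt ℝ (fun v => F' v B) (Set.range I) u)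
    (a : Fin d) (B : Fin k → TIdx d) :
    nabla I G u (fun v B => F v B + F' v B) a B = nabla I G u F a B + nabla I G u F' a B := by
  simp only [nabla, pd_add hu (hF B) (hF' B), mul_add, Finset.sum_add_distrib]
  ring

/-- The Leibniz rule for the tractor connection. -/
theorem nabla_mul
    (hu : u ∈ Set.range I)
    {s : EuclideanSpace ℝ (Fin d) → ℂ}
    (hs : DifferentiableWithinAt ℝ s (Set.range I) u)
    (hF : ∀ B, DifferentiableWithinAt ℝ (fun v => F v B) (Set.range I) u)
    (a : Fin d) (B : Fin k → TIdx d) :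
    nabla I G u (fun v B => s v * F v B) a B
      = pd I a s u * F u B + s u * nabla I G u F a B := by
  simp only [nabla, pd_mul hu hs (hF B), mul_add, Finset.mul_sum, add_assoc]
  simp only [mul_left_comm]

/-- The outer derivative sees the germ of the inner one at `u`, so the Leibniz rule is needed on a
neighbourhood and not just at `u`. -/
theorem nabla_nabla_mul
    (hu : u ∈ Set.range I)
    (hG : ∀ a b, ContDiffWithinAt ℝ ∞ (fun v => G v a b) (Set.range I) u)
    (hdet : (G u).det ≠ 0)
    (hF : ∀ B, ContDiffWithinAt ℝ ∞ (fun v => F v B) (Set.range I) u)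
    {s : EuclideanSpace ℝ (Fin d) → ℂ} (hs : ContDiffWithinAt ℝ ∞ s (Set.range I) u)
    (a b : Fin d) (B : Fin k → TIdx d) :
    nabla I G u (fun v => nabla I G v (fun v B => s v * F v B) b) a B
      = pd I a (pd I b s) u * F u B + pd I b s u * nabla I G u F a B
        + (pd I a s u * nabla I G u F b B
          + s u * nabla I G u (fun v => nabla I G v F b) a B) := by
  have hne : (∞ : WithTop ℕ∞) ≠ 0 := by simp
  have ev : ∀ {f : EuclideanSpace ℝ (Fin d) → ℂ}, ContDiffWithinAt ℝ ∞ f (Set.range I) u →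
      ∀ᶠ v in nhdsWithin u (Set.range I), DifferentiableWithinAt ℝ f (Set.range I) v := by
    intro f hf
    -- Differentiability at a point spreads to nearby points only from a finite order of smoothness,
    -- hence the drop from `∞` to `1`.
    have := (hf.of_le (m := 1) (by exact_mod_cast le_top)).eventually (by simp)
    rw [Set.insert_eq_of_mem hu] at this
    exact this.mono fun v hv => hv.differentiableWithinAt (by simp)
  have hev : ∀ B, (fun v => nabla I G v (fun v B => s v * F v B) b B)
      =ᶠ[nhdsWithin u (Set.range I)]
        fun v => pd I b s v * F v B + s v * nabla I G v F b B := by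
    intro B
    filter_upwards [ev hs, Filter.eventually_all.2 fun B => ev (hF B), self_mem_nhdsWithin]
      with v h1 h2 h3
    exact nabla_mul h3 h1 h2 b B
  have hs' := contDiffWithinAt_pd hu hs b
  have hF' := contDiffWithinAt_nabla hu hG hdet hF b
  rw [nabla_congr hu hev, nabla_add hu, nabla_mul hu (hs'.differentiableWithinAt hne)
    fun B => (hF B).differentiableWithinAt hne,
    nabla_mul hu (hs.differentiableWithinAt hne) fun B => (hF' B).differentiableWithinAt hne]
  · exact fun B => (hs'.mul (hF B)).differentiableWithinAt hne
  · exact fun B => (hs.mul (hF' B)).differentiableWithinAt hne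

theorem inv_symm (hsymm : (G u).IsSymm) (a b : Fin d) : (G u)⁻¹ a b = (G u)⁻¹ b a := by
  conv_lhs => rw [← hsymm, ← Matrix.transpose_nonsing_inv]
  rfl

/-- `Δ(sF) = (Δs) F + 2 g^{ab} (∇_a s) ∇_b F + s ΔF`. -/
theorem laplacian_mul
    (hu : u ∈ Set.range I)
    (hG : ∀ a b, ContDiffWithinAt ℝ ∞ (fun v => G v a b) (Set.range I) u)
    (hdet : (G u).det ≠ 0)
    (hF : ∀ B, ContDiffWithinAt ℝ ∞ (fun v => F v B) (Set.range I) u)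
    {s : EuclideanSpace ℝ (Fin d) → ℂ} (hs : ContDiffWithinAt ℝ ∞ s (Set.range I) u)
    (hsymm : (G u).IsSymm) (B : Fin k → TIdx d) :
    laplacian I G u (fun v B => s v * F v B) B
      = laplacian I G u (fun v (_ : Fin 0 → TIdx d) => s v) Fin.elim0 * F u B
        + 2 * (∑ a, ∑ b, ((G u)⁻¹ a b : ℂ) * pd I a s u * nabla I G u F b B)
        + s u * laplacian I G u F B := by
  have hne : (∞ : WithTop ℕ∞) ≠ 0 := by simp
  have hsw : ∑ a, ∑ b, ((G u)⁻¹ a b : ℂ) * pd I b s u * nabla I G u F a B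
      = ∑ a, ∑ b, ((G u)⁻¹ a b : ℂ) * pd I a s u * nabla I G u F b B := by
    rw [Finset.sum_comm]
    refine Finset.sum_congr rfl fun a _ => Finset.sum_congr rfl fun b _ => ?_
    rw [inv_symm hsymm]
  rw [two_mul]
  -- The two cross terms differ by exchanging `a` and `b`. Writing one copy in each order lets the
  -- double sums be compared term by term.
  nth_rewrite 1 [← hsw]
  simp only [laplacian, nabla_scalar, nabla_nabla_mul hu hG hdet hF hs,
    nabla_mul hu (hs.differentiableWithinAt hne) fun B => (hF B).differentiableWithinAt hne,
    Finset.sum_mul, Finset.mul_sum, ← Finset.sum_add_distrib]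
  refine Finset.sum_congr rfl fun a _ => Finset.sum_congr rfl fun b _ => ?_
  have hΓ : ∑ c, (christoffel I G u c a b : ℂ) * (pd I c s u * F u B + s u * nabla I G u F c B)
      = (∑ c, (christoffel I G u c a b : ℂ) * pd I c s u) * F u B
        + s u * ∑ c, (christoffel I G u c a b : ℂ) * nabla I G u F c B := by
    rw [Finset.sum_mul, Finset.mul_sum, ← Finset.sum_add_distrib]
    exact Finset.sum_congr rfl fun c _ => by ring
  rw [hΓ]
  ring

end CoordinateCalculus

/-! ### Linear algebra in the standard basis -/

section EuclideanFrame

variable {d : ℕ}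

theorem sum_smul_single (v : EuclideanSpace ℝ (Fin d)) :
    ∑ a, v a • (EuclideanSpace.single a 1 : EuclideanSpace ℝ (Fin d)) = v := by
  ext b
  simp [Finset.sum_apply, Pi.single_apply]

theorem det_ne_zero_of_nondegenerate
    (β : LinearMap.BilinForm ℝ (EuclideanSpace ℝ (Fin d)))
    (hβ : ∀ X, (∀ Y, β X Y = 0) → X = 0) :
    (Matrix.of fun a b => β (EuclideanSpace.single a 1) (EuclideanSpace.single b 1)).det ≠ 0 := by
  intro h
  obtain ⟨x, hx, hx0⟩ := Matrix.exists_vecMul_eq_zero_iff.2 h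
  refine hx (congrArg WithLp.ofLp (hβ (WithLp.toLp 2 x) fun Y => ?_))
  rw [← sum_smul_single Y, map_sum]
  refine Finset.sum_eq_zero fun b _ => ?_
  have hb : β (WithLp.toLp 2 x) (EuclideanSpace.single b 1) = 0 := by
    rw [← sum_smul_single (WithLp.toLp 2 x)]
    simpa [Matrix.vecMul, dotProduct, LinearMap.sum_apply] using congrFun hx0 b
  rw [map_smul, hb, smul_zero]

end EuclideanFrame

/-! ### Tractor components at the centre of a chart -/

section Frames

variable {d : ℕ} {H : Type*} [TopologicalSpace H]
  {I : ModelWithCorners ℝ (EuclideanSpace ℝ (Fin d)) H}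
  {M : Type*} [TopologicalSpace M] [ChartedSpace H M]

variable (I) in
/-- The frame of `ℝ ⊕ T_pM ⊕ ℝ` dual to the coordinate functions `coordAt`. -/
def frameAt (p : M) : TIdx d → ℝ × TangentSpace I p × ℝ
  | .inl _ => (1, 0, 0)
  | .inr (.inl a) => (0, (EuclideanSpace.single a 1 : EuclideanSpace ℝ (Fin d)), 0)
  | .inr (.inr _) => (0, 0, 1)

theorem coordAt_frameAt (p : M) (A B : TIdx d) :
    coordAt I p A (frameAt I p B) = if A = B then 1 else 0 := by
  rcases A with _ | a | _ <;> rcases B with _ | b | _ <;> simp [coordAt, frameAt]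
  · exact (EuclideanSpace.proj a : EuclideanSpace ℝ (Fin d) →L[ℝ] ℝ).map_zero
  · exact PiLp.single_apply 2 ℝ b 1 a
  · exact (EuclideanSpace.proj a : EuclideanSpace ℝ (Fin d) →L[ℝ] ℝ).map_zero

theorem sum_coordAt_smul_frameAt (p : M) (T : ℝ × TangentSpace I p × ℝ) :
    ∑ A, coordAt I p A T • frameAt I p A = T := by
  obtain ⟨s, v, r⟩ := T
  simp only [Fintype.sum_sum_type, coordAt, frameAt]
  ext1
  · simp [Prod.fst_sum]
  ext1
  · simp only [Prod.snd_sum, Prod.fst_sum, Prod.snd_add, Prod.fst_add, Prod.smul_snd,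
      Prod.smul_fst, smul_zero, Finset.sum_const_zero, zero_add, add_zero]
    exact sum_smul_single (d := d) v
  · simp [Prod.snd_sum]

theorem ofComponents_frameAt {k : ℕ} (p : M) (C : (Fin k → TIdx d) → ℂ) (B : Fin k → TIdx d) :
    ofComponents I p C (fun i => frameAt I p (B i)) = C B := by
  simp only [ofComponents, sum_apply, MultilinearMap.smulRight_apply,
    MultilinearMap.compLinearMap_apply, MultilinearMap.mkPiAlgebra_apply, coordAt_frameAt]
  rw [Finset.sum_eq_single B]
  · simp
  · intro B' _ h
    obtain ⟨i, hi⟩ := Function.ne_iff.1 h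
    rw [Finset.prod_eq_zero (Finset.mem_univ i) (if_neg hi), zero_smul]
  · simp

/-- A multilinear map is determined by its values on a frame; this reduces identities of tractors to
identities of components. -/
theorem fibre_ext {k : ℕ} {p : M} {f f' : TractorFibre I k p}
    (h : ∀ B : Fin k → TIdx d, f (fun i => frameAt I p (B i)) = f' fun i => frameAt I p (B i)) :
    f = f' := by
  ext T
  have hT : T = fun i => ∑ A, coordAt I p A (T i) • frameAt I p A :=
    funext fun i => (sum_coordAt_smul_frameAt p (T i)).symm
  rw [hT, MultilinearMap.map_sum, MultilinearMap.map_sum]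
  simp only [MultilinearMap.map_smul_univ, h]

theorem chartMetric_isSymm (g : PseudoRiemannianMetric I M) (p : M)
    (u : EuclideanSpace ℝ (Fin d)) : (chartMetric g p u).IsSymm := by
  ext a b
  exact g.symm _ _ _

/-- The chart target is a neighbourhood of the centre within `Set.range I`, the set on which `pd`
differentiates. -/
theorem contDiffWithinAt_of_target {V : Type*} [NormedAddCommGroup V] [NormedSpace ℝ V]
    {f : EuclideanSpace ℝ (Fin d) → V} (p : M)
    (hf : ContDiffOn ℝ ∞ f (extChartAt I p).target) :
    ContDiffWithinAt ℝ ∞ f (Set.range I) (extChartAt I p p) :=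
  (hf _ (mem_extChartAt_target p)).mono_of_mem_nhdsWithin (extChartAt_target_mem_nhdsWithin p)

variable [IsManifold I ∞ M]

/-- `TangentSpace I p` is identified with `ℝ^d` through the chart at `p`, so the inverse of that
chart has identity derivative at the centre. -/
theorem coordVec_self (p : M) (a : Fin d) :
    coordVec I p (extChartAt I p p) a = (EuclideanSpace.single a 1 : EuclideanSpace ℝ (Fin d)) := by
  have : IsManifold I 1 M := .of_le (n := ∞) (by exact_mod_cast le_top)
  exact DFunLike.congr_fun (mfderivWithin_range_extChartAt_symm (I := I) (x := p))
    (EuclideanSpace.single a 1 : EuclideanSpace ℝ (Fin d))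

theorem chartComp_self {k : ℕ} (f : ∀ q : M, TractorFibre I k q) (p : M) (B : Fin k → TIdx d) :
    chartComp f p (extChartAt I p p) B = f p fun i => frameAt I p (B i) := by
  -- The fibre depends on the base point, which is `p` only propositionally; generalising it to `q`
  -- allows the equation to be eliminated.
  have key : ∀ (q : M) (_ : q = p) (T : TIdx d → ℝ × TangentSpace I q × ℝ),
      T = frameAt I q → f q (fun i => T (B i)) = f p fun i => frameAt I p (B i) := by
    rintro q rfl T rfl
    rfl
  refine key _ (extChartAt_to_inv p) _ ?_
  ext1 A
  rcases A with _ | a | _ <;> simp only [chartFrame, frameAt]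
  rw [coordVec_self]

theorem chartComp_ofComponents {k : ℕ} (C : M → (Fin k → TIdx d) → ℂ) (p : M)
    (B : Fin k → TIdx d) :
    chartComp (fun q => ofComponents I q (C q)) p (extChartAt I p p) B = C p B := by
  rw [chartComp_self, ofComponents_frameAt]

theorem chartMetric_self_det_ne_zero (g : PseudoRiemannianMetric I M) (p : M) :
    (chartMetric g p (extChartAt I p p)).det ≠ 0 := by
  -- The base point is left unsimplified: every tangent space is definitionally `ℝ^d`, so
  -- nondegeneracy applies there directly.
  have h : chartMetric g p (extChartAt I p p) = Matrix.of fun a b =>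
      g.val ((extChartAt I p).symm (extChartAt I p p))
        (EuclideanSpace.single a 1 : EuclideanSpace ℝ (Fin d))
        (EuclideanSpace.single b 1 : EuclideanSpace ℝ (Fin d)) := by
    ext a b
    simp only [chartMetric, Matrix.of_apply]
    rw [coordVec_self, coordVec_self]
  rw [h]
  exact det_ne_zero_of_nondegenerate (d := d) (g.val _) (g.nondegenerate _)

end Frames

/-! ### Slot formulas for `I·D` and `I²`, and the basic commutator -/

section Commutators

variable {d : ℕ} {H : Type*} [TopologicalSpace H]
  {I : ModelWithCorners ℝ (EuclideanSpace ℝ (Fin d)) H}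
  {M : Type*} [TopologicalSpace M] [ChartedSpace H M]
  {c : ConformalStructure I M} {k : ℕ}

/-- The coordinate expression of a density. -/
def chartScalar (σ : TractorField c 0) (g : c.metrics) (p : M)
    (u : EuclideanSpace ℝ (Fin d)) : ℂ := scalar σ g ((extChartAt I p).symm u)

theorem chartComp_scalar (σ : TractorField c 0) (g : c.metrics) (p : M) :
    chartComp (σ g) p = fun u _ => chartScalar σ g p u := by
  ext u B
  exact congrArg (σ g _) (funext fun i => i.elim0)

theorem chartScalar_self (σ : TractorField c 0) (g : c.metrics) (p : M) :
    chartScalar σ g p (extChartAt I p p) = scalar σ g p := by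
  rw [chartScalar, extChartAt_to_inv]

/-- Multiplication of a tractor field by a function, in each scale. -/
theorem chartComp_smul (σ : TractorField c 0) (f : TractorField c k) (g : c.metrics) (p : M) :
    chartComp (fun q => scalar σ g q • f g q) p
      = fun u B => chartScalar σ g p u * chartComp (f g) p u B := rfl

theorem contDiffWithinAt_chartMetric (g : c.metrics) (p : M) (a b : Fin d) :
    ContDiffWithinAt ℝ ∞ (fun v => chartMetric g.1 p v a b) (Set.range I) (extChartAt I p p) :=
  contDiffWithinAt_of_target p (g.1.smooth p a b)

theorem IsSection.contDiffWithinAt {w : ℂ} {f : TractorField c k} (hf : IsSection c w f)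
    (g : c.metrics) (p : M) (B : Fin k → TIdx d) :
    ContDiffWithinAt ℝ ∞ (fun v => chartComp (f g) p v B) (Set.range I) (extChartAt I p p) :=
  contDiffWithinAt_of_target p (hf.smooth g p B)

/-- Contraction with the tractor metric, in slots. -/
theorem contract_frameAt (V : TractorField c 1) (F : TractorField c (k + 1)) (g : c.metrics)
    (p : M) (B : Fin k → TIdx d) :
    contract V F g p (fun i => frameAt I p (B i)) =
      chartComp (V g) p (extChartAt I p p) (fun _ => .inl ()) *
          chartComp (F g) p (extChartAt I p p) (Fin.cons (.inr (.inr ())) B)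
        + (∑ a, ∑ b, ((chartMetric g.1 p (extChartAt I p p))⁻¹ a b : ℂ) *
          chartComp (V g) p (extChartAt I p p) (fun _ => .inr (.inl a)) *
          chartComp (F g) p (extChartAt I p p) (Fin.cons (.inr (.inl b)) B))
        + chartComp (V g) p (extChartAt I p p) (fun _ => .inr (.inr ())) *
          chartComp (F g) p (extChartAt I p p) (Fin.cons (.inl ()) B) := by
  rw [contract, ofComponents_frameAt]
  simp [Fintype.sum_sum_type, tractorMetric, add_assoc]

variable [IsManifold I ∞ M]

theorem chartComp_thomasD (w : ℂ) (f : TractorField c k) (g : c.metrics) (p : M)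
    (A : Fin (k + 1) → TIdx d) :
    chartComp (thomasD w f g) p (extChartAt I p p) A =
      thomasDComp I (chartMetric g.1 p) (extChartAt I p p) (chartComp (f g) p) w A :=
  chartComp_ofComponents (fun q =>
    thomasDComp I (chartMetric g.1 q) (extChartAt I q q) (chartComp (f g) q) w) p A

theorem chartComp_scaleTractor (σ : TractorField c 0) (g : c.metrics) (p : M)
    (A : Fin 1 → TIdx d) :
    chartComp (scaleTractor σ g) p (extChartAt I p p) A =
      (1 / (d : ℂ)) *
        thomasDComp I (chartMetric g.1 p) (extChartAt I p p) (chartComp (σ g) p) 1 A := by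
  rw [← chartComp_thomasD]
  rfl

variable (σ : TractorField c 0) (g : c.metrics) (p : M)

/-- The bottom slot of the scale tractor, `-(Δσ + Jσ) / d`. -/
def scaleTractorBottom : ℂ :=
  -(1 / (d : ℂ)) * (laplacian I (chartMetric g.1 p) (extChartAt I p p)
      (fun v (_ : Fin 0 → TIdx d) => chartScalar σ g p v) Fin.elim0
    + (schoutenTrace I (chartMetric g.1 p) (extChartAt I p p) : ℂ) * scalar σ g p)

/-- At weight `1` the factor `d + 2w - 2` is `d`, which the normalisation `1/d` cancels; the middle
slot works the same way. -/
theorem scaleTractor_top (hd : d ≠ 0) {A : Fin 1 → TIdx d} (hA : A 0 = .inl ()) :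
    chartComp (scaleTractor σ g) p (extChartAt I p p) A = scalar σ g p := by
  have hd' : (d : ℂ) ≠ 0 := Nat.cast_ne_zero.2 hd
  rw [chartComp_scaleTractor, thomasDComp, hA, chartComp_scalar]
  simp only [chartScalar_self]
  field_simp
  ring

theorem scaleTractor_middle (hd : d ≠ 0) {A : Fin 1 → TIdx d} {a : Fin d}
    (hA : A 0 = .inr (.inl a)) :
    chartComp (scaleTractor σ g) p (extChartAt I p p) A
      = pd I a (chartScalar σ g p) (extChartAt I p p) := by
  have hd' : (d : ℂ) ≠ 0 := Nat.cast_ne_zero.2 hd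
  rw [chartComp_scaleTractor, thomasDComp, hA, chartComp_scalar]
  simp only [nabla_scalar]
  field_simp
  ring

theorem scaleTractor_bottom {A : Fin 1 → TIdx d} (hA : A 0 = .inr (.inr ())) :
    chartComp (scaleTractor σ g) p (extChartAt I p p) A = scaleTractorBottom σ g p := by
  rw [chartComp_scaleTractor, thomasDComp, hA, chartComp_scalar, scaleTractorBottom]
  simp only [chartScalar_self, Subsingleton.elim (Fin.tail A) Fin.elim0]
  ring

/-- `g^{ab} ∇_a σ ∇_b f`. -/
def gradPairing (f : TractorField c k) (B : Fin k → TIdx d) : ℂ :=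
  ∑ a, ∑ b, ((chartMetric g.1 p (extChartAt I p p))⁻¹ a b : ℂ) *
    pd I a (chartScalar σ g p) (extChartAt I p p) *
    nabla I (chartMetric g.1 p) (extChartAt I p p) (chartComp (f g) p) b B

/-- `I·D f = -σ (Δ f + w J f) + (d + 2w - 2) (⟨∇σ, ∇f⟩ + w ρ f)`, with `ρ` the bottom slot
of the scale tractor. -/
theorem degenerateLaplacian_frameAt (hd : d ≠ 0) (w : ℂ) (f : TractorField c k)
    (B : Fin k → TIdx d) :
    degenerateLaplacian σ w f g p (fun i => frameAt I p (B i)) =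
      -(scalar σ g p * (laplacian I (chartMetric g.1 p) (extChartAt I p p) (chartComp (f g) p) B
          + w * (schoutenTrace I (chartMetric g.1 p) (extChartAt I p p) : ℂ) *
            f g p fun i => frameAt I p (B i)))
        + ((d : ℂ) + 2 * w - 2) * (gradPairing σ g p f B
          + w * scaleTractorBottom σ g p * f g p fun i => frameAt I p (B i)) := by
  rw [degenerateLaplacian, contract_frameAt, scaleTractor_top σ g p hd rfl,
    scaleTractor_bottom σ g p rfl]
  have hmid := fun a => scaleTractor_middle σ g p hd (A := fun _ => .inr (.inl a)) rfl
  simp only [hmid, chartComp_thomasD, thomasDComp, Fin.cons_zero, Fin.tail_cons]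
  simp only [chartComp_self, gradPairing, mul_add, Finset.mul_sum,
    mul_left_comm _ ((d : ℂ) + 2 * w - 2)]
  ring

/-- The tractor metric pairs top with bottom, and the two such pairings contribute equally, whence
the factor `2`. -/
theorem scaleTractorSq_eq (hd : d ≠ 0) :
    scaleTractorSq σ g p =
      (∑ a, ∑ b, ((chartMetric g.1 p (extChartAt I p p))⁻¹ a b : ℂ) *
        pd I a (chartScalar σ g p) (extChartAt I p p) *
        pd I b (chartScalar σ g p) (extChartAt I p p))
      + 2 * scalar σ g p * scaleTractorBottom σ g p := by
  have h : scaleTractorSq σ g p = contract (scaleTractor σ) (scaleTractor σ) g p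
      (fun i => frameAt I p (Fin.elim0 (α := TIdx d) i)) :=
    congrArg (contract (scaleTractor σ) (scaleTractor σ) g p) (funext fun i => i.elim0)
  have hmid := fun a => scaleTractor_middle σ g p hd (A := fun _ => .inr (.inl a)) rfl
  have hmid' := fun b => scaleTractor_middle σ g p hd
    (A := Fin.cons (.inr (.inl b)) Fin.elim0) rfl
  rw [h, contract_frameAt, scaleTractor_top σ g p hd (A := fun _ => .inl ()) rfl,
    scaleTractor_bottom σ g p (A := fun _ => .inr (.inr ())) rfl,
    scaleTractor_top σ g p hd (A := Fin.cons (.inl ()) Fin.elim0) rfl,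
    scaleTractor_bottom σ g p (A := Fin.cons (.inr (.inr ())) Fin.elim0) rfl]
  simp only [hmid, hmid']
  ring

variable {σ}

/-- `I·D (σ f) - σ I·D f = (d + 2w) I² f` for `f` of weight `w`. -/
theorem degenerateLaplacian_smul_sub (hd : d ≠ 0) (hσ : IsSection c 1 σ) {w : ℂ}
    {f : TractorField c k} (hf : IsSection c w f) :
    degenerateLaplacian σ (w + 1) (fun g q => scalar σ g q • f g q) g p
        - scalar σ g p • degenerateLaplacian σ w f g p
      = (((d : ℂ) + 2 * w) * scaleTractorSq σ g p) • f g p := by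
  have hd' : (d : ℂ) ≠ 0 := Nat.cast_ne_zero.2 hd
  have hu : extChartAt I p p ∈ Set.range I := Set.mem_range_self _
  have hne : (∞ : WithTop ℕ∞) ≠ 0 := by simp
  have hs : ContDiffWithinAt ℝ ∞ (chartScalar σ g p) (Set.range I) (extChartAt I p p) := by
    have := hσ.contDiffWithinAt g p Fin.elim0
    rwa [chartComp_scalar] at this
  have hF := hf.contDiffWithinAt g p
  refine fibre_ext fun B => ?_
  have hgrad : gradPairing σ g p (fun g q => scalar σ g q • f g q) B
      = (∑ a, ∑ b, ((chartMetric g.1 p (extChartAt I p p))⁻¹ a b : ℂ) *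
          pd I a (chartScalar σ g p) (extChartAt I p p) *
          pd I b (chartScalar σ g p) (extChartAt I p p)) * (f g p fun i => frameAt I p (B i))
        + scalar σ g p * gradPairing σ g p f B := by
    simp only [gradPairing, chartComp_smul,
      nabla_mul hu (hs.differentiableWithinAt hne) fun B => (hF B).differentiableWithinAt hne,
      chartComp_self, chartScalar_self, Finset.sum_mul, Finset.mul_sum,
      ← Finset.sum_add_distrib]
    exact Finset.sum_congr rfl fun a _ => Finset.sum_congr rfl fun b _ => by ring
  rw [sub_apply, smul_apply, smul_apply,
    degenerateLaplacian_frameAt σ g p hd, degenerateLaplacian_frameAt σ g p hd, hgrad,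
    chartComp_smul, laplacian_mul hu (contDiffWithinAt_chartMetric g p)
      (chartMetric_self_det_ne_zero g.1 p) hF hs (chartMetric_isSymm g.1 p _),
    scaleTractorSq_eq σ g p hd, smul_apply]
  -- The definition of `ρ` solved for `Δσ`. Once `Δσ` is eliminated, the `J` terms cancel and what
  -- remains is the polynomial identity closed by `ring`.
  have hL : laplacian I (chartMetric g.1 p) (extChartAt I p p)
      (fun v (_ : Fin 0 → TIdx d) => chartScalar σ g p v) Fin.elim0
      = -(d : ℂ) * scaleTractorBottom σ g p
        - (schoutenTrace I (chartMetric g.1 p) (extChartAt I p p) : ℂ) * scalar σ g p := by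
    rw [scaleTractorBottom]
    field_simp
    ring
  rw [hL]
  simp only [smul_eq_mul, chartComp_self, chartScalar_self, gradPairing]
  ring

/-- `I·D` commutes with multiplication by constants. -/
theorem degenerateLaplacian_const_smul (σ : TractorField c 0) (hd : d ≠ 0) {w' : ℂ}
    {f : TractorField c k} (hf : IsSection c w' f) (w z : ℂ) :
    degenerateLaplacian σ w (z • f) g p = z • degenerateLaplacian σ w f g p := by
  have hu : extChartAt I p p ∈ Set.range I := Set.mem_range_self _
  have hne : (∞ : WithTop ℕ∞) ≠ 0 := by simp
  have hF := hf.contDiffWithinAt g p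
  have hpd : ∀ (z : ℂ) (a : Fin d), pd I a (fun _ => z) = fun _ => 0 := fun z a => by
    ext v
    simp [pd]
  have hcomp : chartComp ((z • f) g) p = fun v B => z * chartComp (f g) p v B := rfl
  have hΔ : ∀ B, laplacian I (chartMetric g.1 p) (extChartAt I p p)
      (fun v B => z * chartComp (f g) p v B) B
      = z * laplacian I (chartMetric g.1 p) (extChartAt I p p) (chartComp (f g) p) B := by
    -- A constant is a scalar function with vanishing derivatives, so the product rule leaves only
    -- its last term.
    intro B
    rw [laplacian_mul hu (contDiffWithinAt_chartMetric g p) (chartMetric_self_det_ne_zero g.1 p)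
      hF contDiffWithinAt_const (chartMetric_isSymm g.1 p _)]
    simp [laplacian, nabla_scalar, hpd]
  refine fibre_ext fun B => ?_
  rw [smul_apply, degenerateLaplacian_frameAt σ g p hd,
    degenerateLaplacian_frameAt σ g p hd, hcomp, hΔ]
  have hgrad : gradPairing σ g p (z • f) B = z * gradPairing σ g p f B := by
    simp only [gradPairing, hcomp, nabla_mul hu (differentiableWithinAt_const z)
      fun B => (hF B).differentiableWithinAt hne, hpd, Finset.mul_sum]
    exact Finset.sum_congr rfl fun a _ => Finset.sum_congr rfl fun b _ => by ring
  rw [hgrad]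
  simp only [Pi.smul_apply, smul_apply, smul_eq_mul]
  ring

end Commutators

/-! ### Weight bookkeeping for `x`, `I·D` and `h` -/

section WeightedOperators

variable {d : ℕ} {H : Type*} [TopologicalSpace H]
  {I : ModelWithCorners ℝ (EuclideanSpace ℝ (Fin d)) H}
  {M : Type*} [TopologicalSpace M] [ChartedSpace H M]
  {c : ConformalStructure I M} {k : ℕ} {σ : TractorField c 0}

theorem opH_apply (F : WeightedField c k) (w : ℂ) : opH F w = ((d : ℂ) + 2 * w) • F w := by
  simp only [opH, opW, Pi.add_apply, Pi.smul_apply, smul_smul, add_smul]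

theorem comm_opH_opX (F : WeightedField c k) : comm opH (opX σ) F = (2 : ℂ) • opX σ F := by
  ext w g p : 3
  simp only [comm, Pi.sub_apply, opH_apply, opX, Pi.smul_apply]
  module

variable [IsManifold I ∞ M]

/-- `h` is `d + 2w` after `I·D` and `d + 2(w + 1)` before it. The latter constant passes through
`I·D` by linearity, and the difference is `-2`. -/
theorem comm_opH_opID (hd : d ≠ 0) {F : WeightedField c k} (hF : IsWeightedSection F) (w : ℂ)
    (g : c.metrics) (p : M) :
    comm opH (opID σ) F w g p = (-2 : ℂ) • opID σ F w g p := by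
  simp only [comm, Pi.sub_apply, opH_apply, opID, Pi.smul_apply,
    degenerateLaplacian_const_smul g p σ hd (hF (w + 1))]
  module

/-- The shifts `w + 1` and `w - 1` cancel, so both compositions act on the same part `F w`, where
the basic commutator applies. -/
theorem opID_opX_sub (hd : d ≠ 0) (hσ : IsSection c 1 σ) {F : WeightedField c k}
    (hF : IsWeightedSection F) (w : ℂ) (g : c.metrics) (p : M) :
    opID σ (opX σ F) w g p - opX σ (opID σ F) w g p
      = scaleTractorSq σ g p • opH F w g p := by
  have h := degenerateLaplacian_smul_sub g p hd hσ (hF w)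
  have e : opX σ F (w + 1) = fun g q => scalar σ g q • F w g q := by
    ext g q : 2
    simp only [opX, add_sub_cancel_right]
  have e' : opX σ (opID σ F) w g p = scalar σ g p • degenerateLaplacian σ w (F w) g p := by
    simp only [opX, opID, sub_add_cancel]
  rw [opID, e, e', h, opH_apply, mul_comm, mul_smul]
  rfl

end WeightedOperators

end ConformalTractor

end

/-! ### The `sl(2)` relations and their contraction -/

open scoped Manifold ContDiff in
open ConformalTractor in
theorem proposition3p3 {d : ℕ} (hd : 3 ≤ d) {H : Type*} [TopologicalSpace H]
    (I : ModelWithCorners ℝ (EuclideanSpace ℝ (Fin d)) H)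
    {M : Type*} [TopologicalSpace M] [ChartedSpace H M] [IsManifold I ∞ M]
    (c : ConformalStructure I M) (σ : TractorField c 0) (hσ : IsSection c 1 σ) :
    ((∀ g p, scaleTractorSq σ g p ≠ 0) →
      ∀ (k : ℕ) (F : WeightedField c k), IsWeightedSection F →
        comm opH (opX σ) F = (2 : ℂ) • opX σ F ∧
        comm opH (opY σ) F = (-2 : ℂ) • opY σ F ∧
        comm (opX σ) (opY σ) F = opH F) ∧
    ((∀ g p, scaleTractorSq σ g p = 0) →
      ∀ (k : ℕ) (F : WeightedField c k), IsWeightedSection F →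
        comm opH (opX σ) F = (2 : ℂ) • opX σ F ∧
        comm opH (-opID σ) F = (-2 : ℂ) • (-opID σ) F ∧
        comm (opX σ) (-opID σ) F = 0) := by
  have hd0 : d ≠ 0 := by omega
  refine ⟨fun hne k F hF => ⟨comm_opH_opX F, ?_, ?_⟩,
    fun hz k F hF => ⟨comm_opH_opX F, ?_, ?_⟩⟩ <;> ext w g p : 3
  · have h := comm_opH_opID (σ := σ) hd0 hF w g p
    simp only [ConformalTractor.comm, Pi.sub_apply, opH_apply, Pi.smul_apply, opY] at h ⊢
    rw [smul_comm, ← smul_sub, h, smul_comm]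
  · have h := opID_opX_sub hd0 hσ hF w g p
    -- The factor `1/I²` stands to the left of `I·D` in `y`, so it is never differentiated and comes
    -- out of the commutator. The minus sign of `y` reverses the order.
    have e : comm (opX σ) (opY σ) F w g p = (1 / scaleTractorSq σ g p) •
        (opID σ (opX σ F) w g p - opX σ (opID σ F) w g p) := by
      simp only [ConformalTractor.comm, Pi.sub_apply, opY]
      simp only [opX, opY]
      module
    rw [e, h, smul_smul, one_div_mul_cancel (hne g p), one_smul]
  · have h := comm_opH_opID (σ := σ) hd0 hF w g p
    simp only [ConformalTractor.comm, Pi.sub_apply, opH_apply, Pi.smul_apply, Pi.neg_apply] at h ⊢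
    -- The relation for `I·D` is linear in that operator, so it passes to `-I·D`.
    rw [smul_neg, smul_neg, ← h]
    abel
  · have h := opID_opX_sub hd0 hσ hF w g p
    have e : comm (opX σ) (-opID σ) F w g p =
        opID σ (opX σ F) w g p - opX σ (opID σ F) w g p := by
      simp only [ConformalTractor.comm, Pi.sub_apply, Pi.neg_apply]
      simp only [opX, Pi.neg_apply]
      module
    rw [e, h, hz, zero_smul]
    rfl
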